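/- Let $A$ be a (not necessarily unital) $C^*$-algebra with positive cone $A_+$. By an ideal of $A$ we mean a two-sided, not necessarily norm-closed ideal, that is, an additive subgroup $I\subseteq A$ with $aI\cup Ia\subseteq I$ for all $a\in A$. For ideals $J,K$, let $JK$ denote the additive subgroup generated by $\{xy : x\in J,\ y\in K\}$. An ideal $I$ is prime if $I\neq A$ and, for all ideals $J,K\subseteq A$, $JK\subseteq I$ implies $J\subseteq I$ or $K\subseteq I$; it is semiprime if, for all ideals $J\subseteq A$, $J^2=JJ\subseteq I$ implies $J\subseteq I$. Put $I_+:=I\cap A_+$. An ideal $I$ is positively spanned if $I$ is the complex linear span of $I_+$; it is hereditary if $0\leq a\leq x$ with $a\in A$ and $x\in I$ implies $a\in I$; and it is a Dixmier ideal if it is positively spanned and hereditary and, for all $x\in A$, $x^*x\in I_+$ if and only if $xx^*\in I_+$. Then every semiprime ideal of $A$, and hence every prime ideal of $A$, is a Dixmier ideal. In particular, every prime or semiprime ideal $I$ of $A$ is positively spanned (hence self-adjoint, meaning $a\in I$ if and only if $a^*\in I$, and closed under multiplication by complex scalars) and hereditary. -/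

import Mathlib

/-! Two-sided ideals of a (not necessarily unital) C⋆-algebra `A` are terms of `TwoSidedIdeal A`:
additive subgroups absorbing multiplication from both sides, with no closedness and no stability
under scalars or under the star built in. -/

namespace CStarIdeal

section Ring

variable {A : Type*} [NonUnitalRing A]

/-- The product `J K`: the additive subgroup generated by all `x * y` with `x ∈ J`, `y ∈ K`. -/
def idealProd (J K : TwoSidedIdeal A) : AddSubgroup A :=
  AddSubgroup.closure {z : A | ∃ x ∈ J, ∃ y ∈ K, z = x * y}

/-- `I` is prime: `I ≠ A`, and `J K ⊆ I` implies `J ⊆ I` or `K ⊆ I`. -/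
def IsPrime (I : TwoSidedIdeal A) : Prop :=
  I ≠ ⊤ ∧ ∀ J K : TwoSidedIdeal A, (idealProd J K : Set A) ⊆ (I : Set A) → J ≤ I ∨ K ≤ I

/-- `I` is semiprime: `J J ⊆ I` implies `J ⊆ I`. -/
def IsSemiprime (I : TwoSidedIdeal A) : Prop :=
  ∀ J : TwoSidedIdeal A, (idealProd J J : Set A) ⊆ (I : Set A) → J ≤ I

end Ring

section CStar

variable {A : Type*} [NonUnitalCStarAlgebra A] [PartialOrder A] [StarOrderedRing A]

/-- The positive part `I ∩ A₊`. -/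
def positivePart (I : TwoSidedIdeal A) : Set A := {a : A | a ∈ I ∧ 0 ≤ a}

/-- `I` is the complex linear span of its positive part. -/
def IsPositivelySpanned (I : TwoSidedIdeal A) : Prop :=
  (I : Set A) = (Submodule.span ℂ (positivePart I) : Set A)

/-- If `0 ≤ a ≤ x` and `x ∈ I`, then `a ∈ I`. -/
def IsHereditary (I : TwoSidedIdeal A) : Prop :=
  ∀ a x : A, 0 ≤ a → a ≤ x → x ∈ I → a ∈ I

/-- A set `M` of positive elements is strongly invariant: `x⋆ x ∈ M` if and only if `x x⋆ ∈ M`. -/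
def IsStronglyInvariant (M : Set A) : Prop :=
  ∀ x : A, star x * x ∈ M ↔ x * star x ∈ M

/-- A Dixmier ideal: positively spanned, hereditary, with strongly invariant positive part. -/
structure IsDixmier (I : TwoSidedIdeal A) : Prop where
  positivelySpanned : IsPositivelySpanned I
  hereditary : IsHereditary I
  stronglyInvariant : IsStronglyInvariant (positivePart I)

/-- `a ∈ I` if and only if `a⋆ ∈ I`. -/
def IsSelfAdjointIdeal (I : TwoSidedIdeal A) : Prop :=
  ∀ a : A, a ∈ I ↔ star a ∈ I

/-- `I` is closed under multiplication by complex scalars. -/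
def IsScalarClosed (I : TwoSidedIdeal A) : Prop :=
  ∀ (c : ℂ) (x : A), x ∈ I → c • x ∈ I

end CStar

end CStarIdeal

/-!
The heart of the matter is that a semiprime ideal `I` contains the square roots of its positive
elements (`IsSemiprime.sqrt_mem`). In a semiprime ideal, `x A x ⊆ I` forces `x ∈ I`
(`IsSemiprime.mem_of_mul_mul_mem`). If `c` is self-adjoint and `c³ ∈ I`, then
`c² b c² = z c³ + c³ z'` for suitable `z, z' ∈ A`, for every `b`; hence `c² A c² ⊆ I`, so `c² ∈ I`.
The elements `z, z'` come from a telescoping series: with `pₙ = qₙ(c) c² → c²` for functions `qₙ`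
that cut off the spectrum of `c` below `2⁻ⁿ`, the increments of `pₙ b pₙ` are
`(pₙ₊₁ - pₙ) b pₙ₊₁ + pₙ b (pₙ₊₁ - pₙ)`, in which the differences have norm of order `4⁻ⁿ`, while
dividing `pₙ` by `c³` costs only a factor of order `2ⁿ` (`exists_mul_mul_eq`). Thus `a ∈ I` gives
`a ^ (2 / 3) ∈ I` for `a ≥ 0`, and twice this gives `a ^ (4 / 9) ∈ I`, whence `√a ∈ I`.

The second tool is the factorization `z = s y` whenever `z z⋆ ≤ s⁴` with `s` self-adjoint
(`exists_eq_mul_of_mul_star_le`). Together with fourth roots it shows that `z ∈ I` as soon as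
`z z⋆ ≤ w ∈ I` (`IsSemiprime.mem_of_mul_star_le`). For `x ∈ I`, the elements `z = x⋆` and
`z = c x` satisfy this with `w = z z⋆`, which gives stability under the star and under scalars; for
`0 ≤ a ≤ w`, the choice `z = √a` gives heredity. Strong invariance follows from
`(x x⋆)² = x (x⋆ x) x⋆`, and positive spanning from `|h| = √(h²) ∈ I` for self-adjoint `h ∈ I`.
-/

open Filter Topology
open scoped NNReal

namespace CStarIdeal

/-! ### Semiprime ideals of rings -/

section Ring

variable {A : Type*} [NonUnitalRing A] {I : TwoSidedIdeal A}

theorem IsPrime.isSemiprime (hI : IsPrime I) : IsSemiprime I :=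
  fun J hJ => (hI.2 J J hJ).elim id id

theorem IsSemiprime.le_of_forall_mul_mem (hI : IsSemiprime I) {J : TwoSidedIdeal A}
    (h : ∀ x ∈ J, ∀ y ∈ J, x * y ∈ I) : J ≤ I := by
  refine hI J ?_
  have : idealProd J J ≤ AddSubgroup.ofClass I := by
    rw [idealProd, AddSubgroup.closure_le]
    rintro _ ⟨x, hx, y, hy, rfl⟩
    exact h x hx y hy
  exact fun x hx => this hx

/-- The elements annihilating `A` from the left modulo `I` form an ideal whose square is in `I`. -/
theorem IsSemiprime.mem_of_forall_mul_right_mem (hI : IsSemiprime I) {x : A}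
    (h : ∀ a, x * a ∈ I) : x ∈ I := by
  let T : TwoSidedIdeal A := .mk' {y | ∀ a, y * a ∈ I}
    (fun a => by simp [I.zero_mem])
    (fun hx hy a => by simpa [add_mul] using I.add_mem (hx a) (hy a))
    (fun hx a => by simpa using I.neg_mem (hx a))
    (fun hy a => by simpa [mul_assoc] using I.mul_mem_left _ _ (hy a))
    (fun hx a => by simpa [mul_assoc] using hx _)
  have hT : ∀ y, y ∈ T ↔ ∀ a, y * a ∈ I := fun y => TwoSidedIdeal.mem_mk' ..
  exact hI.le_of_forall_mul_mem (J := T) (fun y hy z _ => (hT y).1 hy z) ((hT x).2 h)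

theorem IsSemiprime.mem_of_forall_mul_left_mem (hI : IsSemiprime I) {x : A}
    (h : ∀ a, a * x ∈ I) : x ∈ I := by
  let T : TwoSidedIdeal A := .mk' {y | ∀ a, a * y ∈ I}
    (fun a => by simp [I.zero_mem])
    (fun hx hy a => by simpa [mul_add] using I.add_mem (hx a) (hy a))
    (fun hx a => by simpa using I.neg_mem (hx a))
    (fun {u _} hy a => by simpa [mul_assoc] using hy (a * u))
    (fun hx a => by simpa [mul_assoc] using I.mul_mem_right _ _ (hx a))
  have hT : ∀ y, y ∈ T ↔ ∀ a, a * y ∈ I := fun y => TwoSidedIdeal.mem_mk' ..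
  exact hI.le_of_forall_mul_mem (J := T) (fun y _ z hz => (hT z).1 hz y) ((hT x).2 h)

/-- The elementwise form of semiprimeness: `x A x ⊆ I` implies `x ∈ I`. -/
theorem IsSemiprime.mem_of_mul_mul_mem (hI : IsSemiprime I) {x : A}
    (h : ∀ b, x * b * x ∈ I) : x ∈ I := by
  -- Since `A` need not be unital, the ideal to square is the one generated by `A x A`.
  let J : TwoSidedIdeal A := TwoSidedIdeal.span {z | ∃ u v, z = u * x * v}
  let M : TwoSidedIdeal A := .mk' {q | ∀ v, x * v * q ∈ I}
    (fun a => by simp [I.zero_mem])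
    (fun hx hy a => by simpa [mul_add] using I.add_mem (hx a) (hy a))
    (fun hx a => by simpa using I.neg_mem (hx a))
    (fun {u _} hy a => by simpa [mul_assoc] using hy (a * u))
    (fun hx a => by simpa [mul_assoc] using I.mul_mem_right _ _ (hx a))
  have hM : ∀ q, q ∈ M ↔ ∀ v, x * v * q ∈ I := fun q => TwoSidedIdeal.mem_mk' ..
  have hJM : J ≤ M := by
    rw [TwoSidedIdeal.span_le]
    rintro _ ⟨u, v, rfl⟩
    refine (hM _).2 fun w => ?_
    simpa [mul_assoc] using I.mul_mem_right _ v (h (w * u))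
  let N : TwoSidedIdeal A := .mk' {p | ∀ q ∈ J, p * q ∈ I}
    (fun q _ => by simp [I.zero_mem])
    (fun hx hy q hq => by simpa [add_mul] using I.add_mem (hx q hq) (hy q hq))
    (fun hx q hq => by simpa using I.neg_mem (hx q hq))
    (fun hy q hq => by simpa [mul_assoc] using I.mul_mem_left _ _ (hy q hq))
    (fun hx q hq => by simpa [mul_assoc] using hx _ (J.mul_mem_left _ _ hq))
  have hN : ∀ p, p ∈ N ↔ ∀ q ∈ J, p * q ∈ I := fun q => TwoSidedIdeal.mem_mk' ..
  have hJN : J ≤ N := by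
    rw [TwoSidedIdeal.span_le]
    rintro _ ⟨u, v, rfl⟩
    refine (hN _).2 fun q hq => ?_
    simpa [mul_assoc] using I.mul_mem_left u _ ((hM q).1 (hJM hq) v)
  have hJI : J ≤ I := hI.le_of_forall_mul_mem fun p hp q hq => (hN p).1 (hJN hp) q hq
  exact hI.mem_of_forall_mul_right_mem fun v => hI.mem_of_forall_mul_left_mem fun u =>
    hJI (TwoSidedIdeal.subset_span ⟨u, v, (mul_assoc _ _ _).symm⟩)

end Ring

section CStar

variable {A : Type*} [NonUnitalCStarAlgebra A]

/-! ### Approximate inverses and factorizations -/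

/-- Approximate inverses `rₙ = c (c² + 4⁻ⁿ)⁻¹` of a self-adjoint element `c`, with control of the
rate at which `c rₙ` acts as a unit on `c` and on `c²`. -/
theorem exists_approx_inverse {c : A} (hc : IsSelfAdjoint c) :
    ∃ r : ℕ → A, ∀ n, IsSelfAdjoint (r n) ∧ Commute c (r n) ∧ ‖r n‖ ≤ 2 ^ n ∧
      ‖r n * (c * c) - c‖ ≤ (1 / 2) ^ n ∧ ‖r n * (c * c * c) - c * c‖ ≤ (1 / 4) ^ n := by
  refine ⟨fun n => cfcₙ (fun t : ℝ => t / (t ^ 2 + ((1 / 2 : ℝ) ^ n) ^ 2)) c, fun n => ?_⟩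
  set δ : ℝ := (1 / 2 : ℝ) ^ n with hδ
  have hδ0 : 0 < δ := by positivity
  have hpos : ∀ t : ℝ, 0 < t ^ 2 + δ ^ 2 := fun t => by positivity
  have hcont : Continuous fun t : ℝ => t / (t ^ 2 + δ ^ 2) :=
    continuous_id.div (by fun_prop) fun t => (hpos t).ne'
  have hco := hcont.continuousOn (s := quasispectrum ℝ c)
  have hid : cfcₙ (fun t : ℝ => t) c = c := cfcₙ_id' ℝ c
  have hcc : cfcₙ (fun t : ℝ => t * t) c = c * c := by
    rw [cfcₙ_mul (fun t : ℝ => t) (fun t => t) c, hid]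
  have hccc : cfcₙ (fun t : ℝ => t * t * t) c = c * c * c := by
    rw [cfcₙ_mul (fun t : ℝ => t * t) (fun t => t) c, hid, hcc]
  refine ⟨cfcₙ_predicate _ c, ?_, norm_cfcₙ_le fun t _ => ?_, ?_, ?_⟩
  · simpa only [hid] using cfcₙ_commute_cfcₙ (fun t : ℝ => t) (fun t => t / (t ^ 2 + δ ^ 2)) c
  · have h2 : (2 : ℝ) ^ n = 1 / δ := by simp [hδ]
    rw [h2, Real.norm_eq_abs, abs_div, abs_of_pos (hpos t), div_le_div_iff₀ (hpos t) hδ0,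
      ← sq_abs t]
    nlinarith [sq_nonneg (|t| - δ), abs_nonneg t]
  · have : cfcₙ (fun t : ℝ => t / (t ^ 2 + δ ^ 2)) c * (c * c) - c =
        cfcₙ (fun t : ℝ => t / (t ^ 2 + δ ^ 2) * (t * t) - t) c := by
      rw [cfcₙ_sub _ _ c, cfcₙ_mul _ _ c hco, hcc, hid]
    change ‖cfcₙ (fun t : ℝ => t / (t ^ 2 + δ ^ 2)) c * (c * c) - c‖ ≤ δ
    rw [this]
    refine norm_cfcₙ_le fun t _ => ?_
    have : t / (t ^ 2 + δ ^ 2) * (t * t) - t = -(t * δ ^ 2) / (t ^ 2 + δ ^ 2) := by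
      field_simp [(hpos t).ne']; ring
    rw [this, Real.norm_eq_abs, abs_div, abs_of_pos (hpos t), div_le_iff₀ (hpos t), abs_neg,
      abs_mul, abs_of_pos (by positivity : 0 < δ ^ 2), ← sq_abs t]
    nlinarith [sq_nonneg (|t| - δ), abs_nonneg t, mul_nonneg hδ0.le (sq_nonneg (|t| - δ)),
      mul_nonneg hδ0.le (sq_nonneg |t|), pow_pos hδ0 3, mul_nonneg (sq_nonneg δ) (abs_nonneg t)]
  · have h4 : (1 / 4 : ℝ) ^ n = δ ^ 2 := by rw [hδ, ← pow_mul, mul_comm, pow_mul]; norm_num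
    rw [← hccc, ← hcc, ← cfcₙ_mul _ _ c hco, ← cfcₙ_sub _ _ c, h4]
    refine norm_cfcₙ_le fun t _ => ?_
    have : t / (t ^ 2 + δ ^ 2) * (t * t * t) - t * t = -(t ^ 2 * δ ^ 2) / (t ^ 2 + δ ^ 2) := by
      field_simp [(hpos t).ne']; ring
    rw [this, Real.norm_eq_abs, abs_div, abs_of_pos (hpos t), div_le_iff₀ (hpos t), abs_neg,
      abs_of_nonneg (by positivity)]
    nlinarith [sq_nonneg (δ ^ 2)]

/-- Every `c² b c²` lies in `A c³ + c³ A`, although `c²` is in general not a multiple of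
`c³`: the increments of `pₙ b pₙ`, where `pₙ = rₙ c³ → c²`, sum up to it after division by `c³`. -/
theorem exists_mul_mul_eq {c : A} (hc : IsSelfAdjoint c) (b : A) :
    ∃ z z' : A, c * c * b * (c * c) = z * (c * c * c) + c * c * c * z' := by
  obtain ⟨r, hr⟩ := exists_approx_inverse hc
  set k := c * c * c with hk
  let p : ℕ → A := fun n => r n * k
  have hp : ∀ n, p n = k * r n := fun n =>
    (((hr n).2.1.mul_left (hr n).2.1).mul_left (hr n).2.1).eq.symm
  have hpn : ∀ n, ‖p n - c * c‖ ≤ (1 / 4) ^ n := fun n => (hr n).2.2.2.2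
  have hd : ∀ n, ‖p (n + 1) - p n‖ ≤ 2 * (1 / 4) ^ n := fun n => by
    have h1 := hpn (n + 1)
    have h2 : (1 / 4 : ℝ) ^ (n + 1) ≤ (1 / 4) ^ n :=
      pow_le_pow_of_le_one (by norm_num) (by norm_num) n.le_succ
    calc ‖p (n + 1) - p n‖ = ‖(p (n + 1) - c * c) - (p n - c * c)‖ := by congr 1; abel
      _ ≤ _ := (norm_sub_le _ _).trans (by linarith [hpn n])
  have hlim : Tendsto p atTop (𝓝 (c * c)) := by
    rw [tendsto_iff_norm_sub_tendsto_zero]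
    exact squeeze_zero (fun _ => norm_nonneg _) hpn
      (tendsto_pow_atTop_nhds_zero_of_lt_one (by norm_num) (by norm_num))
  have hgeom : ∀ n : ℕ, (2 * (1 / 4 : ℝ) ^ n) * 2 ^ n = 2 * (1 / 2) ^ n := fun n => by
    rw [mul_assoc, ← mul_pow]; norm_num
  have hgs : Summable fun n : ℕ => 4 * ‖b‖ * (1 / 2 : ℝ) ^ n :=
    (summable_geometric_of_lt_one (by norm_num) (by norm_num)).mul_left _
  let f : ℕ → A := fun n => (p (n + 1) - p n) * b * r (n + 1)
  let g : ℕ → A := fun n => r n * b * (p (n + 1) - p n)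
  have hf : Summable f := by
    refine .of_norm_bounded hgs fun n => ?_
    calc ‖f n‖ ≤ ‖p (n + 1) - p n‖ * ‖b‖ * ‖r (n + 1)‖ := norm_mul₃_le
      _ ≤ 2 * (1 / 4) ^ n * ‖b‖ * 2 ^ (n + 1) := by gcongr; exacts [hd n, (hr _).2.2.1]
      _ = 2 * ‖b‖ * (2 * (1 / 4 : ℝ) ^ n * 2 ^ n) := by ring
      _ = _ := by rw [hgeom]; ring
  have hg : Summable g := by
    refine .of_norm_bounded hgs fun n => ?_
    calc ‖g n‖ ≤ ‖r n‖ * ‖b‖ * ‖p (n + 1) - p n‖ := norm_mul₃_le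
      _ ≤ 2 ^ n * ‖b‖ * (2 * (1 / 4) ^ n) := by gcongr; exacts [(hr _).2.2.1, hd n]
      _ = ‖b‖ * (2 * (1 / 4 : ℝ) ^ n * 2 ^ n) := by ring
      _ = 2 * ‖b‖ * (1 / 2) ^ n := by rw [hgeom]; ring
      _ ≤ _ := by gcongr; norm_num
  have hsum := (hf.hasSum.mul_right k).add (hg.hasSum.mul_left k)
  have hterm : ∀ n, f n * k + k * g n = p (n + 1) * b * p (n + 1) - p n * b * p n := fun n => by
    have h1 : f n * k = (p (n + 1) - p n) * b * p (n + 1) := by simp only [f, p, mul_assoc]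
    have h2 : k * g n = p n * b * (p (n + 1) - p n) := by simp only [g, hp n, mul_assoc]
    rw [h1, h2]; noncomm_ring
  have htel := hsum.tendsto_sum_nat
  simp only [hterm] at htel
  have hseq : Tendsto (fun n => p n * b * p n - p 0 * b * p 0) atTop
      (𝓝 (c * c * b * (c * c) - p 0 * b * p 0)) :=
    ((hlim.mul_const b).mul hlim).sub_const _
  have heq := tendsto_nhds_unique
    (htel.congr fun n => Finset.sum_range_sub (fun n => p n * b * p n) n) hseq
  refine ⟨∑' n, f n, (∑' n, g n) + r 0 * b * p 0, ?_⟩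
  rw [mul_add, ← add_assoc, heq, hp 0]
  simp only [mul_assoc, sub_add_cancel]

variable [PartialOrder A] [StarOrderedRing A]

theorem norm_mul_le_of_mul_star_le {s z d : A} (hs : IsSelfAdjoint s) (hd : IsSelfAdjoint d)
    (h : z * star z ≤ s * s * (s * s)) : ‖d * z‖ ≤ ‖d * (s * s)‖ := by
  have key : ∀ w : A, (d * w) * star (d * w) = d * (w * star w) * d := fun w => by
    simp only [star_mul, hd.star_eq, mul_assoc]
  have hss : star (s * s) = s * s := by rw [star_mul, hs.star_eq]
  have h1 : (d * z) * star (d * z) ≤ (d * (s * s)) * star (d * (s * s)) := by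
    rw [key, key, hss]
    exact hd.conjugate_le_conjugate h
  have h2 := CStarAlgebra.norm_le_norm_of_nonneg_of_le (mul_star_self_nonneg _) h1
  rw [CStarRing.norm_self_mul_star, CStarRing.norm_self_mul_star] at h2
  exact abs_le_of_sq_le_sq' (by simpa [sq] using h2) (norm_nonneg _) |>.2

/-- If `z z⋆ ≤ s⁴`, then `z` is divisible by `s` on the left: the quotient is the limit of
`rₙ z` for approximate inverses `rₙ` of `s`. -/
theorem exists_eq_mul_of_mul_star_le {s z : A} (hs : IsSelfAdjoint s)
    (h : z * star z ≤ s * s * (s * s)) : ∃ y, z = s * y := by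
  obtain ⟨r, hr⟩ := exists_approx_inverse hs
  have hcau : CauchySeq fun n => r n * z := by
    refine cauchySeq_of_le_geometric (1 / 2) 2 (by norm_num) fun n => ?_
    have h1 := (hr n).2.2.2.1
    have h2 := (hr (n + 1)).2.2.2.1
    have h3 : (1 / 2 : ℝ) ^ (n + 1) ≤ (1 / 2) ^ n :=
      pow_le_pow_of_le_one (by norm_num) (by norm_num) n.le_succ
    rw [dist_eq_norm, ← sub_mul]
    refine (norm_mul_le_of_mul_star_le hs ((hr n).1.sub (hr (n + 1)).1) h).trans ?_
    calc ‖(r n - r (n + 1)) * (s * s)‖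
        = ‖(r n * (s * s) - s) - (r (n + 1) * (s * s) - s)‖ := by
          rw [sub_mul]; congr 1; abel
      _ ≤ _ := (norm_sub_le _ _).trans (by linarith)
  obtain ⟨y, hy⟩ := cauchySeq_tendsto_of_complete hcau
  refine ⟨y, ?_⟩
  have hlim : Tendsto (fun n => r n * (s * s)) atTop (𝓝 s) := by
    rw [tendsto_iff_norm_sub_tendsto_zero]
    exact squeeze_zero (fun _ => norm_nonneg _) (fun n => (hr n).2.2.2.1)
      (tendsto_pow_atTop_nhds_zero_of_lt_one (by norm_num) (by norm_num))
  have hss : s * (s * y) = s * z := by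
    refine tendsto_nhds_unique (f := fun n => s * (s * (r n * z)))
      ((hy.const_mul s).const_mul s) ((hlim.mul_const z).congr fun n => ?_)
    have hcomm := ((hr n).2.1.mul_left (hr n).2.1).eq
    rw [← hcomm]; simp only [mul_assoc]
  -- It remains to cancel `s`: the defect `v` satisfies `s v = 0`, hence `z⋆ v = 0`.
  set v := s * y - z with hv
  have hsv : s * v = 0 := by rw [hv, mul_sub, hss, sub_self]
  have hvs : star v * s = 0 := by simpa [hs.star_eq] using congrArg star hsv
  have hzv : star z * v = 0 := by
    rw [← CStarRing.star_mul_self_eq_zero_iff]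
    refine le_antisymm ?_ (star_mul_self_nonneg _)
    calc star (star z * v) * (star z * v) = star v * (z * star z) * v := by
          simp only [star_mul, star_star, mul_assoc]
      _ ≤ star v * (s * s * (s * s)) * v := star_left_conjugate_le_conjugate h v
      _ = 0 := by simp only [mul_assoc, hsv, mul_zero]
  have hvz : star v * z = 0 := by simpa using congrArg star hzv
  have hv0 : star v * v = 0 := by
    nth_rewrite 2 [hv]
    rw [mul_sub, hvz, ← mul_assoc, hvs, zero_mul, sub_zero]
  rw [CStarRing.star_mul_self_eq_zero_iff] at hv0
  exact (sub_eq_zero.1 hv0).symm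

/-! ### Semiprime ideals are closed under roots -/

variable {I : TwoSidedIdeal A}

theorem IsSemiprime.nnrpow_two_thirds_mem (hI : IsSemiprime I) {a : A} (ha : 0 ≤ a)
    (h : a ∈ I) : a ^ (2 / 3 : ℝ≥0) ∈ I := by
  set c := a ^ (1 / 3 : ℝ≥0) with hc
  have hc0 : 0 ≤ c := CFC.nnrpow_nonneg
  have h2 : c * c = a ^ (2 / 3 : ℝ≥0) := by
    rw [hc, ← CFC.nnrpow_add (by norm_num) (by norm_num)]
    congr 1; norm_num
  have h3 : c * c * c = a := by
    rw [h2, hc, ← CFC.nnrpow_add (by norm_num) (by norm_num)]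
    convert CFC.nnrpow_one a using 2
    rw [← add_div]; norm_num
  rw [← h2]
  refine hI.mem_of_mul_mul_mem fun b => ?_
  obtain ⟨z, z', hz⟩ := exists_mul_mul_eq hc0.isSelfAdjoint b
  rw [hz, h3]
  exact I.add_mem (I.mul_mem_left _ _ h) (I.mul_mem_right _ _ h)

theorem IsSemiprime.sqrt_mem (hI : IsSemiprime I) {a : A} (ha : 0 ≤ a) (h : a ∈ I) :
    CFC.sqrt a ∈ I := by
  have h1 := hI.nnrpow_two_thirds_mem CFC.nnrpow_nonneg (hI.nnrpow_two_thirds_mem ha h)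
  rw [CFC.nnrpow_nnrpow] at h1
  -- The exponent `(2 / 3)² = 4 / 9` is below `1 / 2`.
  have h2 : CFC.sqrt a = a ^ (2 / 3 * (2 / 3) : ℝ≥0) * a ^ (1 / 18 : ℝ≥0) := by
    rw [CFC.sqrt_eq_nnrpow, ← CFC.nnrpow_add (by norm_num) (by norm_num)]
    congr 1
    apply NNReal.coe_injective
    push_cast
    norm_num
  rw [h2]
  exact I.mul_mem_right _ _ h1

/-- With fourth roots available in `I`, domination of `z z⋆` by an element of `I` puts `z` itself
in `I`. -/
theorem IsSemiprime.mem_of_mul_star_le (hI : IsSemiprime I) {w z : A} (hw : w ∈ I)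
    (h : z * star z ≤ w) : z ∈ I := by
  have hw0 : 0 ≤ w := (mul_star_self_nonneg z).trans h
  have hs : CFC.sqrt (CFC.sqrt w) ∈ I :=
    hI.sqrt_mem (CFC.sqrt_nonneg _) (hI.sqrt_mem hw0 hw)
  obtain ⟨y, rfl⟩ := exists_eq_mul_of_mul_star_le
    (s := CFC.sqrt (CFC.sqrt w)) (z := z) (CFC.sqrt_nonneg _).isSelfAdjoint (by
      rwa [CFC.sqrt_mul_sqrt_self _ (CFC.sqrt_nonneg _), CFC.sqrt_mul_sqrt_self _ hw0])
  exact I.mul_mem_right _ _ hs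

/-! ### Consequences for semiprime ideals -/

theorem IsSemiprime.star_mem (hI : IsSemiprime I) {x : A} (hx : x ∈ I) : star x ∈ I :=
  hI.mem_of_mul_star_le (I.mul_mem_left (star x) x hx) (by rw [star_star])

theorem IsSemiprime.isSelfAdjointIdeal (hI : IsSemiprime I) : IsSelfAdjointIdeal I :=
  fun a => ⟨hI.star_mem, fun h => by simpa using hI.star_mem h⟩

theorem IsSemiprime.isScalarClosed (hI : IsSemiprime I) : IsScalarClosed I := by
  intro c x hx
  -- `I` absorbs ring elements, not scalars, but `(c x) (c x)⋆` is a ring multiple of `x`.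
  refine hI.mem_of_mul_star_le (w := x * (c • star (c • x))) (I.mul_mem_right _ _ hx) ?_
  rw [smul_mul_assoc, mul_smul_comm]

theorem IsSemiprime.isHereditary (hI : IsSemiprime I) : IsHereditary I := by
  intro a x ha hax hx
  have h : CFC.sqrt a ∈ I := hI.mem_of_mul_star_le hx (by
    rwa [(CFC.sqrt_nonneg a).isSelfAdjoint.star_eq, CFC.sqrt_mul_sqrt_self a ha])
  rw [← CFC.sqrt_mul_sqrt_self a ha]
  exact I.mul_mem_left _ _ h

theorem IsSemiprime.mul_star_mem (hI : IsSemiprime I) {x : A} (h : star x * x ∈ I) :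
    x * star x ∈ I := by
  have h2 : x * star x * (x * star x) ∈ I := by
    simpa only [mul_assoc] using I.mul_mem_left x _ (I.mul_mem_right _ (star x) h)
  rw [← CFC.sqrt_mul_self (x * star x) (mul_star_self_nonneg x)]
  refine hI.sqrt_mem ?_ h2
  simpa using mul_star_self_nonneg (x * star x)

theorem IsSemiprime.isStronglyInvariant (hI : IsSemiprime I) :
    IsStronglyInvariant (positivePart I) := fun x =>
  ⟨fun h => ⟨hI.mul_star_mem h.1, mul_star_self_nonneg x⟩, fun h =>
    ⟨by simpa using hI.mul_star_mem (x := star x) (by simpa using h.1), star_mul_self_nonneg x⟩⟩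

theorem IsSemiprime.mem_span_of_isSelfAdjoint (hI : IsSemiprime I) {x : A}
    (hx : IsSelfAdjoint x) (h : x ∈ I) : x ∈ Submodule.span ℂ (positivePart I) := by
  have habs : CFC.abs x ∈ I := hI.sqrt_mem (star_mul_self_nonneg x) (I.mul_mem_left _ _ h)
  have hsub : CFC.abs x - x ∈ positivePart I := by
    refine ⟨I.sub_mem habs h, ?_⟩
    rw [CFC.abs_sub_self x hx]
    exact nsmul_nonneg (CFC.negPart_nonneg x) 2
  rw [← sub_sub_cancel (CFC.abs x) x]
  exact Submodule.sub_mem _ (Submodule.subset_span ⟨habs, CFC.abs_nonneg x⟩)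
    (Submodule.subset_span hsub)

theorem IsSemiprime.isPositivelySpanned (hI : IsSemiprime I) : IsPositivelySpanned I := by
  apply Set.Subset.antisymm
  · intro x hx
    have hx' : x ∈ I := hx
    have hstar := hI.star_mem hx'
    have h1 := hI.mem_span_of_isSelfAdjoint (IsSelfAdjoint.add_star_self x)
      (I.add_mem hx' hstar)
    have h2 := hI.mem_span_of_isSelfAdjoint (x := Complex.I • (x - star x))
      (by simp [isSelfAdjoint_iff, sub_eq_add_neg, add_comm])
      (hI.isScalarClosed _ _ (I.sub_mem hx' hstar))
    have hdec : x = (1 / 2 : ℂ) • (x + star x) +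
        (-(1 / 2) * Complex.I : ℂ) • (Complex.I • (x - star x)) := by
      rw [smul_smul, mul_assoc, Complex.I_mul_I]
      module
    rw [SetLike.mem_coe, hdec]
    exact Submodule.add_mem _ (Submodule.smul_mem _ _ h1) (Submodule.smul_mem _ _ h2)
  · intro x hx
    refine Submodule.span_induction (p := fun x _ => x ∈ I) (fun x h => h.1) I.zero_mem
      (fun _ _ _ _ => I.add_mem) (fun c y _ => hI.isScalarClosed c y) hx

theorem IsSemiprime.isDixmier (hI : IsSemiprime I) : IsDixmier I :=
  ⟨hI.isPositivelySpanned, hI.isHereditary, hI.isStronglyInvariant⟩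

end CStar

end CStarIdeal

theorem corollary4p5 {A : Type*} [NonUnitalCStarAlgebra A] [PartialOrder A] [StarOrderedRing A] :
    (∀ I : TwoSidedIdeal A, CStarIdeal.IsSemiprime I → CStarIdeal.IsDixmier I) ∧
    (∀ I : TwoSidedIdeal A, CStarIdeal.IsPrime I → CStarIdeal.IsDixmier I) ∧
    (∀ I : TwoSidedIdeal A, CStarIdeal.IsSemiprime I ∨ CStarIdeal.IsPrime I →
      CStarIdeal.IsPositivelySpanned I ∧ CStarIdeal.IsSelfAdjointIdeal I ∧
      CStarIdeal.IsScalarClosed I ∧ CStarIdeal.IsHereditary I) := by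
  refine ⟨fun I hI => hI.isDixmier, fun I hI => hI.isSemiprime.isDixmier, fun I hI => ?_⟩
  have hI' : CStarIdeal.IsSemiprime I := hI.elim id CStarIdeal.IsPrime.isSemiprime
  exact ⟨hI'.isPositivelySpanned, hI'.isSelfAdjointIdeal, hI'.isScalarClosed, hI'.isHereditary⟩
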